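/- Proposition 3.3 (Compensator of potential kernel). Let $a$ be a probability distribution on $\mathbb Z$ which defines an irreducible and aperiodic random walk on $\mathbb Z$ and satisfies $\sum_x x\,a(x)=0$ and $\sum_x |x|^{3+\eta}a(x)<\infty$ for some $\eta>0$, and put $\sigma^2:=\sum_x x^2a(x)$. Let $\bar P(x,x+y):=\sum_{z\in\mathbb Z}a(z+y)a(z)$ for $x,y\in\mathbb Z$, let $\bar P^s$ be the $s$-th power of this transition matrix (with $\bar P^0(x,y)=1_{\{x=y\}}$), and let $\bar G_t(x,y):=\sum_{s=0}^t\bar P^s(x,y)$. Then for every $x\in\mathbb Z$ the limit $$\bar A(x):=\lim_{t\to\infty}\big[\bar G_t(0,0)-\bar G_t(x,0)\big]$$ exists and is finite ($\bar A$ is called the potential kernel of the random walk with kernel $\bar P$), and the following hold. (a) Let $0<\varepsilon\le 1$ and let $S=(S(t))_{t\in\mathbb N_0}$ be a Markov chain on $\mathbb Z$ (the sticky difference walk), relative to some filtration $(\mathcal F_t)_{t\in\mathbb N_0}$, with $\mathbb E|S(0)|<\infty$ and transition kernel $$P(0,y)=(1-\varepsilon)1_{\{y=0\}}+\varepsilon\bar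 P(0,y),\qquad P(x,y)=\bar P(x,y)\quad(x\ne 0).$$ That is, $S$ is adapted to $(\mathcal F_t)$ and $\mathbb P(S(t+1)=y\mid\mathcal F_t)=P(S(t),y)$ almost surely for all $t\in\mathbb N_0$ and $y\in\mathbb Z$. Then $$\bar A(S(t))-\varepsilon\sum_{s=0}^{t-1}1_{\{S(s)=0\}}\qquad(t\in\mathbb N_0)$$ is a martingale with respect to $(\mathcal F_t)$. (b) $\displaystyle\lim_{|x|\to\infty}\frac{\bar A(x)}{|x|}=\frac1{2\sigma^2}.$ -/

import Mathlib

open Filter Topology MeasureTheory ProbabilityTheory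

namespace StickyWalk

noncomputable section

/-- The `t`-th power of an infinite matrix `P` on `ℤ`, with `P⁰(x,y) = 1_{x=y}`. -/
def kernelPow (P : ℤ → ℤ → ℝ) : ℕ → ℤ → ℤ → ℝ
  | 0 => fun x y => if x = y then 1 else 0
  | t + 1 => fun x y => ∑' z : ℤ, P x z * kernelPow P t z y

/-- Transition matrix of the random walk on `ℤ` with increment distribution `a`. -/
def walkKernel (a : ℤ → ℝ) (x y : ℤ) : ℝ := a (y - x)

/-- Every state can be reached from every other state with positive probability. -/
def Irreducible (P : ℤ → ℤ → ℝ) : Prop :=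
  ∀ x y : ℤ, ∃ t : ℕ, 0 < kernelPow P t x y

/-- For every state `x`, the return times `{t ≥ 1 : Pᵗ(x,x) > 0}` have greatest common
divisor `1`: the only natural number dividing all of them is `1`. -/
def Aperiodic (P : ℤ → ℤ → ℝ) : Prop :=
  ∀ x : ℤ, ∀ d : ℕ, (∀ t : ℕ, 0 < t → 0 < kernelPow P t x x → d ∣ t) → d = 1

/-- `a` is a probability distribution on `ℤ` that defines an irreducible and aperiodic random
walk, has mean zero, and has a finite moment of order `3 + η` for some `η > 0`. -/
structure IsStepLaw (a : ℤ → ℝ) : Prop where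
  nonneg : ∀ x, 0 ≤ a x
  hasSum_one : HasSum a 1
  irreducible : Irreducible (walkKernel a)
  aperiodic : Aperiodic (walkKernel a)
  mean_zero : HasSum (fun x : ℤ => (x : ℝ) * a x) 0
  moment : ∃ η : ℝ, 0 < η ∧ Summable (fun x : ℤ => |(x : ℝ)| ^ (3 + η) * a x)

/-- `σ² = ∑ₓ x² a(x)`. -/
def sigmaSq (a : ℤ → ℝ) : ℝ := ∑' x : ℤ, (x : ℝ) ^ 2 * a x

/-- The symmetrized kernel, `P̄(x, x + y) = ∑_z a(z + y) a(z)`. -/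
def symKernel (a : ℤ → ℝ) (x y : ℤ) : ℝ := ∑' z : ℤ, a (z + (y - x)) * a z

/-- The kernel of the sticky difference walk: it agrees with `P̄` away from the origin, and at
the origin the walk stays put with probability `1 - ε` and moves by `P̄` with probability `ε`. -/
def stickyKernel (a : ℤ → ℝ) (ε : ℝ) (x y : ℤ) : ℝ :=
  if x = 0 then (1 - ε) * (if y = 0 then 1 else 0) + ε * symKernel a x y
  else symKernel a x y

/-- `Ḡ_t(x,y) = ∑_{s=0}^t P̄ˢ(x,y)`. -/
def greenSum (a : ℤ → ℝ) (t : ℕ) (x y : ℤ) : ℝ :=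
  ∑ s ∈ Finset.range (t + 1), kernelPow (symKernel a) s x y

/-- The potential kernel `Ā(x) = lim_{t → ∞} [Ḡ_t(0,0) - Ḡ_t(x,0)]` of the walk with kernel `P̄`.
(`limUnder` is a meaningful value only where the limit exists.) -/
def potentialKernel (a : ℤ → ℝ) (x : ℤ) : ℝ :=
  limUnder atTop (fun t : ℕ => greenSum a t 0 0 - greenSum a t x 0)

/-- `S` is a Markov chain on `ℤ` with transition matrix `P`, relative to the filtration `ℱ`:
`S` is adapted to `ℱ` and `ℙ(S(t+1) = y | ℱ_t) = P(S(t), y)` almost surely, for all `t`, `y`. -/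
structure IsMarkovChain {Ω : Type*} {m : MeasurableSpace Ω} (P : ℤ → ℤ → ℝ) (S : ℕ → Ω → ℤ)
    (ℱ : Filtration ℕ m) (μ : Measure Ω) : Prop where
  adapted : ∀ t, Measurable[ℱ t] (S t)
  transition : ∀ (t : ℕ) (y : ℤ),
    μ[fun ω => if S (t + 1) ω = y then (1 : ℝ) else 0 | ℱ t] =ᵐ[μ] fun ω => P (S t ω) y

end

end StickyWalk

namespace StickyWalk

/-! Let `b` be the law of the difference of two independent steps, `ψ` its (real) Fourier transform.
Cosines are eigenfunctions of convolution with `b`, so the difference of Green sums is `(2π)⁻¹ ∫ (1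
- cos xθ)(1 - ψ^(t+1)) / (1 - ψ)` over `[-π, π]`. The singularity at `0` is removed by dividing
numerator and denominator by `1 - cos θ`: the numerator becomes the Fejér kernel `F_x`, the
denominator a continuous function `q` with `q(0) = 2σ²`. Irreducibility and aperiodicity give `q >
0`, so dominated convergence yields `Ā(x) = (2π)⁻¹ ∫ F_x / q` (`tendsto_sum_kernelPow_sub`).

Both claims are read off this formula. Convolving `1 - cos xθ` with `b` adds `cos(xθ)(1 - ψ)`; after
division by `1 - ψ` and integration this is `1_{x=0}` (`hasSum_fourierPotential`), the compensator
at the origin. And `F_x` has mass `2π|x|`, of which only a bounded part lies away from `0`, so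
`Ā(x)/|x| → 1/q(0)` (`exists_abs_fourierPotential_sub_le`). -/

/-! ### The Fejér kernel -/

open Finset in
/-- The unnormalized Fejér kernel `|∑_{k < |n|} e^{ikθ}|²`. -/
noncomputable def fejer (n : ℤ) (θ : ℝ) : ℝ :=
  ‖∑ k ∈ range n.natAbs, Complex.exp (θ * Complex.I) ^ k‖ ^ 2

lemma fejer_nonneg (n : ℤ) (θ : ℝ) : 0 ≤ fejer n θ := sq_nonneg _

lemma continuous_fejer (n : ℤ) : Continuous (fejer n) := by
  unfold fejer; fun_prop

lemma fejer_le (n : ℤ) (θ : ℝ) : fejer n θ ≤ (n : ℝ) ^ 2 := by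
  have h : ‖∑ k ∈ Finset.range n.natAbs, Complex.exp (θ * Complex.I) ^ k‖ ≤ n.natAbs := by
    refine (norm_sum_le _ _).trans ?_
    simp [Complex.norm_exp_ofReal_mul_I]
  have h2 : ((n.natAbs : ℝ)) ^ 2 = (n : ℝ) ^ 2 := by
    rw [Nat.cast_natAbs, Int.cast_abs, sq_abs]
  rw [← h2]
  exact pow_le_pow_left₀ (norm_nonneg _) h 2

lemma norm_exp_mul_I_sub_one_sq (α : ℝ) :
    ‖Complex.exp (α * Complex.I) - 1‖ ^ 2 = 2 * (1 - Real.cos α) := by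
  rw [Complex.sq_norm, Complex.normSq_apply]
  simp only [Complex.sub_re, Complex.sub_im, Complex.exp_ofReal_mul_I_re,
    Complex.exp_ofReal_mul_I_im, Complex.one_re, Complex.one_im]
  nlinarith [Real.sin_sq_add_cos_sq α]

lemma cos_natAbs_mul (n : ℤ) (θ : ℝ) : Real.cos (n.natAbs * θ) = Real.cos (n * θ) := by
  rw [Nat.cast_natAbs, Int.cast_abs]
  rcases abs_choice (n : ℝ) with h | h <;> rw [h]
  rw [neg_mul, Real.cos_neg]

/-- Squared norms in the geometric sum formula `(∑ w^k)(w - 1) = w^|n| - 1`, with `w = e^{iθ}`. -/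
lemma fejer_mul_one_sub_cos (n : ℤ) (θ : ℝ) :
    fejer n θ * (1 - Real.cos θ) = 1 - Real.cos (n * θ) := by
  have h := congrArg (fun z => ‖z‖ ^ 2) (geom_sum_mul (Complex.exp (θ * Complex.I)) n.natAbs)
  have h2 : Complex.exp (θ * Complex.I) ^ n.natAbs
      = Complex.exp (((n.natAbs * θ : ℝ) : ℂ) * Complex.I) := by
    rw [← Complex.exp_nat_mul]; push_cast; ring_nf
  simp only [norm_mul, mul_pow, h2, norm_exp_mul_I_sub_one_sq, cos_natAbs_mul] at h
  unfold fejer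
  linarith

lemma fejer_of_cos_eq_one (n : ℤ) {θ : ℝ} (hθ : Real.cos θ = 1) : fejer n θ = (n : ℝ) ^ 2 := by
  have h : Complex.exp (θ * Complex.I) = 1 := by
    have := norm_exp_mul_I_sub_one_sq θ
    rw [hθ] at this
    simpa [sub_eq_zero] using this
  simp only [fejer, h, one_pow, Finset.sum_const, Finset.card_range, nsmul_eq_mul, mul_one,
    Complex.norm_natCast]
  rw [Nat.cast_natAbs, Int.cast_abs, sq_abs]

lemma integral_cos_int_mul (m : ℤ) :
    ∫ θ in -Real.pi..Real.pi, Real.cos (m * θ) = if m = 0 then 2 * Real.pi else 0 := by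
  split_ifs with h
  · simp [h]; ring
  · rw [intervalIntegral.integral_comp_mul_left (fun θ => Real.cos θ) (Int.cast_ne_zero.2 h)]
    simp [Real.sin_int_mul_pi]

lemma fejer_eq_sum_cos (n : ℤ) (θ : ℝ) :
    fejer n θ = ∑ j ∈ Finset.range n.natAbs, ∑ k ∈ Finset.range n.natAbs,
      Real.cos (((j : ℤ) - (k : ℤ) : ℤ) * θ) := by
  have h (k : ℕ) : Complex.exp (θ * Complex.I) ^ k
      = Complex.exp (((k * θ : ℝ) : ℂ) * Complex.I) := by
    rw [← Complex.exp_nat_mul]; push_cast; ring_nf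
  unfold fejer
  rw [Complex.sq_norm, Complex.normSq_apply]
  simp only [h, Complex.re_sum, Complex.im_sum, Complex.exp_ofReal_mul_I_re,
    Complex.exp_ofReal_mul_I_im, Finset.sum_mul_sum, ← Finset.sum_add_distrib, ← Real.cos_sub]
  push_cast
  simp only [sub_mul]

/-- In the double sum of cosines only the `|n|` diagonal terms have a nonzero integral. -/
lemma integral_fejer (n : ℤ) :
    ∫ θ in -Real.pi..Real.pi, fejer n θ = 2 * Real.pi * |(n : ℝ)| := by
  simp only [fejer_eq_sum_cos]
  rw [intervalIntegral.integral_finsetSum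
    fun i _ => (Continuous.intervalIntegrable (by fun_prop) _ _)]
  have (j : ℕ) : ∫ θ in -Real.pi..Real.pi, ∑ k ∈ Finset.range n.natAbs,
      Real.cos (((j : ℤ) - (k : ℤ) : ℤ) * θ)
      = ∑ k ∈ Finset.range n.natAbs, if j = k then 2 * Real.pi else 0 := by
    rw [intervalIntegral.integral_finsetSum
      fun i _ => (Continuous.intervalIntegrable (by fun_prop) _ _)]
    simp only [integral_cos_int_mul, sub_eq_zero, Nat.cast_inj]
  simp only [this, Finset.sum_ite_eq]
  rw [Finset.sum_congr rfl (g := fun _ => 2 * Real.pi) fun i hi => by simp [Finset.mem_range.1 hi]]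
  simp [Nat.cast_natAbs]; ring

lemma cos_ne_one_ae : ∀ᵐ θ : ℝ, θ ∈ Set.uIoc (-Real.pi) Real.pi → Real.cos θ ≠ 1 := by
  have : ∀ᵐ θ : ℝ, θ ≠ 0 := by simp [ae_iff]
  filter_upwards [this] with θ h hm hc
  rw [Set.uIoc_of_le (by linarith [Real.pi_pos])] at hm
  exact h ((Real.cos_eq_one_iff_of_lt_of_lt (by linarith [hm.1, Real.pi_pos])
    (by linarith [hm.2, Real.pi_pos])).1 hc)

/-! ### Fourier analysis of a symmetric law -/

/-- The Fourier transform of a symmetric law `b`. -/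
noncomputable def cosTransform (b : ℤ → ℝ) (θ : ℝ) : ℝ := ∑' y : ℤ, b y * Real.cos (y * θ)

/-- The quotient `(1 - ψ(θ)) / (1 - cos θ)`, where `ψ` is the Fourier transform of `b`,
extended continuously to `θ = 0`. -/
noncomputable def cosQuotient (b : ℤ → ℝ) (θ : ℝ) : ℝ := ∑' y : ℤ, b y * fejer y θ

/-- The Fourier representation of the potential kernel. -/
noncomputable def fourierPotential (b : ℤ → ℝ) (x : ℤ) : ℝ :=
  (2 * Real.pi)⁻¹ * ∫ θ in -Real.pi..Real.pi, fejer x θ / cosQuotient b θ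

/-- A symmetric law with finite variance, an atom at `0` and nowhere vanishing `cosQuotient`. -/
structure IsSymmetricLaw (b : ℤ → ℝ) : Prop where
  nonneg : ∀ y, 0 ≤ b y
  hasSum_one : HasSum b 1
  symm : ∀ y, b (-y) = b y
  summable_sq : Summable fun y : ℤ => (y : ℝ) ^ 2 * b y
  zero_pos : 0 < b 0
  cosQuotient_pos : ∀ θ, 0 < cosQuotient b θ

namespace IsSymmetricLaw

variable {b : ℤ → ℝ}

lemma summable_mul_of_abs_le_one (h0 : ∀ y, 0 ≤ b y) (h1 : Summable b) {f : ℤ → ℝ}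
    (hf : ∀ y, |f y| ≤ 1) : Summable fun y => b y * f y := by
  refine Summable.of_norm_bounded h1 fun y => ?_
  rw [Real.norm_eq_abs, abs_mul, abs_of_nonneg (h0 y)]
  exact mul_le_of_le_one_right (h0 y) (hf y)

lemma hasSum_cosTransform (h0 : ∀ y, 0 ≤ b y) (h1 : Summable b) (θ : ℝ) :
    HasSum (fun y : ℤ => b y * Real.cos (y * θ)) (cosTransform b θ) :=
  (summable_mul_of_abs_le_one h0 h1 fun _ => Real.abs_cos_le_one _).hasSum

lemma continuous_cosTransform (h0 : ∀ y, 0 ≤ b y) (h1 : Summable b) :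
    Continuous (cosTransform b) := by
  refine continuous_tsum (fun y => by fun_prop) h1 fun y θ => ?_
  rw [Real.norm_eq_abs, abs_mul, abs_of_nonneg (h0 y)]
  exact mul_le_of_le_one_right (h0 y) (Real.abs_cos_le_one _)

lemma norm_mul_fejer_le (h0 : ∀ y, 0 ≤ b y) (y : ℤ) (θ : ℝ) :
    ‖b y * fejer y θ‖ ≤ (y : ℝ) ^ 2 * b y := by
  rw [Real.norm_of_nonneg (mul_nonneg (h0 y) (fejer_nonneg y θ)), mul_comm]
  exact mul_le_mul_of_nonneg_right (fejer_le y θ) (h0 y)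

lemma hasSum_cosQuotient (h0 : ∀ y, 0 ≤ b y) (h2 : Summable fun y : ℤ => (y : ℝ) ^ 2 * b y)
    (θ : ℝ) : HasSum (fun y : ℤ => b y * fejer y θ) (cosQuotient b θ) :=
  (Summable.of_norm_bounded h2 fun y => norm_mul_fejer_le h0 y θ).hasSum

lemma continuous_cosQuotient (h0 : ∀ y, 0 ≤ b y)
    (h2 : Summable fun y : ℤ => (y : ℝ) ^ 2 * b y) : Continuous (cosQuotient b) :=
  continuous_tsum (fun y => (continuous_fejer y).const_mul _) h2 fun y θ => norm_mul_fejer_le h0 y θ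

lemma cosQuotient_mul (h0 : ∀ y, 0 ≤ b y) (h1 : HasSum b 1)
    (h2 : Summable fun y : ℤ => (y : ℝ) ^ 2 * b y) (θ : ℝ) :
    cosQuotient b θ * (1 - Real.cos θ) = 1 - cosTransform b θ := by
  have h := (hasSum_cosQuotient h0 h2 θ).mul_right (1 - Real.cos θ)
  refine h.unique ((h1.sub (hasSum_cosTransform h0 h1.summable θ)).congr_fun fun y => ?_)
  rw [mul_assoc, fejer_mul_one_sub_cos]; ring

lemma cosQuotient_of_cos_eq_one {θ : ℝ} (hθ : Real.cos θ = 1) :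
    cosQuotient b θ = ∑' y : ℤ, (y : ℝ) ^ 2 * b y := by
  simp only [cosQuotient, fejer_of_cos_eq_one _ hθ, mul_comm]

variable (hb : IsSymmetricLaw b)
include hb

/-- All terms of `1 + ψ = ∑ b(y)(1 + cos yθ)` are nonnegative and `y = 0` contributes `2 b(0) > 0`.
-/
lemma neg_one_lt_cosTransform (θ : ℝ) : -1 < cosTransform b θ := by
  have h := hb.hasSum_one.add (hasSum_cosTransform hb.nonneg hb.hasSum_one.summable θ)
  have h' := le_hasSum h 0 fun y _ => by
    nlinarith [hb.nonneg y, Real.neg_one_le_cos (y * θ)]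
  simp at h'
  linarith [hb.zero_pos]

lemma cosTransform_le_one (θ : ℝ) : cosTransform b θ ≤ 1 := by
  nlinarith [cosQuotient_mul hb.nonneg hb.hasSum_one hb.summable_sq θ, hb.cosQuotient_pos θ,
    Real.cos_le_one θ]

lemma abs_cosTransform_le_one (θ : ℝ) : |cosTransform b θ| ≤ 1 :=
  abs_le.2 ⟨(hb.neg_one_lt_cosTransform θ).le, hb.cosTransform_le_one θ⟩

lemma abs_cosTransform_lt_one {θ : ℝ} (hθ : Real.cos θ ≠ 1) : |cosTransform b θ| < 1 := by
  refine abs_lt.2 ⟨hb.neg_one_lt_cosTransform θ, ?_⟩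
  have := mul_pos (hb.cosQuotient_pos θ) (sub_pos.2 (lt_of_le_of_ne (Real.cos_le_one θ) hθ))
  linarith [cosQuotient_mul hb.nonneg hb.hasSum_one hb.summable_sq θ]

lemma continuous_quotient : Continuous (cosQuotient b) :=
  continuous_cosQuotient hb.nonneg hb.summable_sq

lemma continuous_transform : Continuous (cosTransform b) :=
  continuous_cosTransform hb.nonneg hb.hasSum_one.summable

lemma continuous_fejer_div (x : ℤ) : Continuous fun θ => fejer x θ / cosQuotient b θ :=
  (continuous_fejer x).div hb.continuous_quotient fun θ => (hb.cosQuotient_pos θ).ne'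

lemma exists_le_cosQuotient :
    ∃ c, 0 < c ∧ ∀ θ ∈ Set.Icc (-Real.pi) Real.pi, c ≤ cosQuotient b θ := by
  obtain ⟨t, -, ht⟩ := isCompact_Icc.exists_isMinOn
    (Set.nonempty_Icc.2 (by linarith [Real.pi_pos] : -Real.pi ≤ Real.pi))
    hb.continuous_quotient.continuousOn
  exact ⟨_, hb.cosQuotient_pos t, ht⟩

lemma hasSum_mul_sin (θ : ℝ) : HasSum (fun y : ℤ => b y * Real.sin (y * θ)) 0 := by
  have h := (summable_mul_of_abs_le_one hb.nonneg hb.hasSum_one.summable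
    fun y : ℤ => Real.abs_sin_le_one (y * θ)).hasSum
  have h' := (Equiv.neg ℤ).hasSum_iff.2 h
  have h'' : HasSum (fun y : ℤ => b y * Real.sin (y * θ))
      (-∑' y : ℤ, b y * Real.sin (y * θ)) := by
    refine h'.neg.congr_fun fun y => ?_
    simp [hb.symm]
  rwa [show ∑' y : ℤ, b y * Real.sin (y * θ) = 0 by linarith [h.unique h'']] at h

/-- Expand the cosine of a difference of angles; the sine part cancels by symmetry of `b`. -/
lemma hasSum_shift_cos (x y : ℤ) (θ : ℝ) :
    HasSum (fun z : ℤ => b (z - x) * Real.cos ((y - z : ℤ) * θ))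
      (Real.cos ((y - x : ℤ) * θ) * cosTransform b θ) := by
  have h := ((hasSum_cosTransform hb.nonneg hb.hasSum_one.summable θ).mul_left
    (Real.cos ((y - x : ℤ) * θ))).add ((hb.hasSum_mul_sin θ).mul_left (Real.sin ((y - x : ℤ) * θ)))
  rw [mul_zero, add_zero, ← (Equiv.subRight x).hasSum_iff] at h
  refine h.congr_fun fun z => ?_
  have : ((y - z : ℤ) : ℝ) * θ = (y - x : ℤ) * θ - (z - x : ℤ) * θ := by push_cast; ring
  rw [this, Real.cos_sub]
  simp only [Function.comp, Equiv.subRight_apply]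
  ring

lemma hasSum_shift (x : ℤ) : HasSum (fun z : ℤ => b (z - x)) 1 :=
  (Equiv.subRight x).hasSum_iff.2 hb.hasSum_one

/-! ### Convergence of the Green sums -/

lemma kernelPow_eq (s : ℕ) (x y : ℤ) :
    kernelPow (fun x y => b (y - x)) s x y
      = (2 * Real.pi)⁻¹ * ∫ θ in -Real.pi..Real.pi,
          Real.cos ((y - x : ℤ) * θ) * cosTransform b θ ^ s := by
  have hψ := hb.continuous_transform
  induction s generalizing x with
  | zero =>
    simp only [kernelPow, pow_zero, mul_one, integral_cos_int_mul, sub_eq_zero, @eq_comm _ y x]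
    split_ifs
    · field_simp
    · simp
  | succ s ih =>
    simp only [kernelPow, ih]
    have key : HasSum (fun z : ℤ => ∫ θ in -Real.pi..Real.pi,
        b (z - x) * Real.cos ((y - z : ℤ) * θ) * cosTransform b θ ^ s)
        (∫ θ in -Real.pi..Real.pi,
          Real.cos ((y - x : ℤ) * θ) * cosTransform b θ * cosTransform b θ ^ s) := by
      refine intervalIntegral.hasSum_integral_of_dominated_convergence (fun z _ => b (z - x))
        (fun z => Continuous.aestronglyMeasurable (by fun_prop)) (fun z => ae_of_all _ fun θ _ => ?_)
        (ae_of_all _ fun θ _ => (hb.hasSum_shift x).summable) ?_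
        (ae_of_all _ fun θ _ => (hb.hasSum_shift_cos x y θ).mul_right _)
      · rw [Real.norm_eq_abs, abs_mul, abs_mul, abs_pow, abs_of_nonneg (hb.nonneg _), mul_assoc]
        exact mul_le_of_le_one_right (hb.nonneg _) (mul_le_one₀ (Real.abs_cos_le_one _)
          (by positivity) (pow_le_one₀ (abs_nonneg _) (hb.abs_cosTransform_le_one θ)))
      · simp [(hb.hasSum_shift x).tsum_eq]
    have := (key.mul_left (2 * Real.pi)⁻¹).tsum_eq
    simp only [pow_succ', ← mul_assoc] at this ⊢
    rw [← this]
    refine tsum_congr fun z => ?_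
    simp only [mul_assoc, intervalIntegral.integral_const_mul]
    ring

/-- The Fourier representation of the difference of Green sums. -/
lemma sum_kernelPow_sub (t : ℕ) (x : ℤ) :
    (∑ s ∈ Finset.range (t + 1), kernelPow (fun x y => b (y - x)) s 0 0)
      - ∑ s ∈ Finset.range (t + 1), kernelPow (fun x y => b (y - x)) s x 0
      = (2 * Real.pi)⁻¹ * ∫ θ in -Real.pi..Real.pi,
          fejer x θ / cosQuotient b θ * (1 - cosTransform b θ ^ (t + 1)) := by
  have hψ := hb.continuous_transform
  simp only [hb.kernelPow_eq]
  rw [← Finset.mul_sum, ← Finset.mul_sum, ← mul_sub, ← Finset.sum_sub_distrib]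
  congr 1
  have (s : ℕ) : (∫ θ in -Real.pi..Real.pi, Real.cos ((0 - 0 : ℤ) * θ) * cosTransform b θ ^ s)
      - (∫ θ in -Real.pi..Real.pi, Real.cos ((0 - x : ℤ) * θ) * cosTransform b θ ^ s)
      = ∫ θ in -Real.pi..Real.pi, (1 - Real.cos (x * θ)) * cosTransform b θ ^ s := by
    rw [← intervalIntegral.integral_sub (Continuous.intervalIntegrable (by fun_prop) _ _)
      (Continuous.intervalIntegrable (by fun_prop) _ _)]
    refine intervalIntegral.integral_congr fun θ _ => ?_
    simp [sub_mul]
  simp only [this]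
  rw [← intervalIntegral.integral_finsetSum
    fun i _ => (Continuous.intervalIntegrable (by fun_prop) _ _)]
  refine intervalIntegral.integral_congr fun θ _ => ?_
  have h := cosQuotient_mul hb.nonneg hb.hasSum_one hb.summable_sq θ
  have hg := geom_sum_mul (cosTransform b θ) (t + 1)
  have hq := (hb.cosQuotient_pos θ).ne'
  -- Cleared of denominators, this is `(1 - ψ) ∑ ψ^s = 1 - ψ^(t+1)` with `1 - ψ = q (1 - cos θ)`.
  rw [← Finset.mul_sum, ← fejer_mul_one_sub_cos, div_mul_eq_mul_div, eq_div_iff hq]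
  linear_combination (fejer x θ * ∑ s ∈ Finset.range (t + 1), cosTransform b θ ^ s) * h
    - fejer x θ * hg

lemma tendsto_sum_kernelPow_sub (x : ℤ) :
    Tendsto (fun t : ℕ => (∑ s ∈ Finset.range (t + 1), kernelPow (fun x y => b (y - x)) s 0 0)
      - ∑ s ∈ Finset.range (t + 1), kernelPow (fun x y => b (y - x)) s x 0)
      atTop (𝓝 (fourierPotential b x)) := by
  have hψ := hb.continuous_transform
  have hf := hb.continuous_fejer_div x
  simp only [hb.sum_kernelPow_sub]
  refine Tendsto.const_mul _ (intervalIntegral.tendsto_integral_filter_of_dominated_convergence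
    (fun θ => fejer x θ / cosQuotient b θ * 2)
    (Eventually.of_forall fun t => Continuous.aestronglyMeasurable (by fun_prop))
    (Eventually.of_forall fun t => ae_of_all _ fun θ _ => ?_)
    (Continuous.intervalIntegrable (by fun_prop) _ _) ?_)
  · have h0 := div_nonneg (fejer_nonneg x θ) (hb.cosQuotient_pos θ).le
    rw [norm_mul, Real.norm_of_nonneg h0]
    refine mul_le_mul_of_nonneg_left ?_ h0
    have h1 : |cosTransform b θ ^ (t + 1)| ≤ 1 := by
      rw [abs_pow]; exact pow_le_one₀ (abs_nonneg _) (hb.abs_cosTransform_le_one θ)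
    rw [Real.norm_eq_abs, abs_le]
    constructor <;> linarith [abs_le.1 h1]
  · filter_upwards [cos_ne_one_ae] with θ hθ hm
    have := (tendsto_pow_atTop_nhds_zero_of_abs_lt_one
      (hb.abs_cosTransform_lt_one (hθ hm))).comp (tendsto_add_atTop_nat 1)
    simpa using (this.const_sub 1).const_mul (fejer x θ / cosQuotient b θ)

lemma fourierPotential_nonneg (x : ℤ) : 0 ≤ fourierPotential b x :=
  mul_nonneg (by positivity) (intervalIntegral.integral_nonneg (by linarith [Real.pi_pos])
    fun θ _ => div_nonneg (fejer_nonneg x θ) (hb.cosQuotient_pos θ).le)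

/-- Bounds `q` below by a positive constant. Linear growth is what makes `Ā(S(0))` integrable. -/
lemma exists_fourierPotential_le : ∃ C, ∀ x : ℤ, fourierPotential b x ≤ C * |(x : ℝ)| := by
  obtain ⟨c, hc, hle⟩ := hb.exists_le_cosQuotient
  refine ⟨c⁻¹, fun x => ?_⟩
  have hf := hb.continuous_fejer_div x
  have hf' := continuous_fejer x
  have : ∫ θ in -Real.pi..Real.pi, fejer x θ / cosQuotient b θ
      ≤ ∫ θ in -Real.pi..Real.pi, fejer x θ / c :=
    intervalIntegral.integral_mono_on (by linarith [Real.pi_pos])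
      (hf.intervalIntegrable _ _) (Continuous.intervalIntegrable (by fun_prop) _ _)
      fun θ hθ => div_le_div_of_nonneg_left (fejer_nonneg x θ) hc (hle θ hθ)
  rw [intervalIntegral.integral_div, integral_fejer] at this
  calc fourierPotential b x ≤ (2 * Real.pi)⁻¹ * (2 * Real.pi * |(x : ℝ)| / c) :=
        mul_le_mul_of_nonneg_left this (by positivity)
    _ = c⁻¹ * |(x : ℝ)| := by field_simp

/-! ### Harmonicity away from the origin -/

lemma hasSum_shift_fejer (x : ℤ) {θ : ℝ} (hθ : Real.cos θ ≠ 1) :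
    HasSum (fun y : ℤ => b (y - x) * fejer y θ)
      (fejer x θ + Real.cos (x * θ) * cosQuotient b θ) := by
  have hne : 1 - Real.cos θ ≠ 0 := sub_ne_zero.2 hθ.symm
  have h := ((hb.hasSum_shift x).sub (hb.hasSum_shift_cos x 0 θ)).div_const (1 - Real.cos θ)
  have hval : fejer x θ + Real.cos (x * θ) * cosQuotient b θ
      = (1 - Real.cos ((0 - x : ℤ) * θ) * cosTransform b θ) / (1 - Real.cos θ) := by
    rw [eq_div_iff hne, add_mul, fejer_mul_one_sub_cos, mul_assoc,
      cosQuotient_mul hb.nonneg hb.hasSum_one hb.summable_sq]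
    simp [mul_sub]
  rw [hval]
  refine h.congr_fun fun y => ?_
  rw [eq_div_iff hne, mul_assoc, fejer_mul_one_sub_cos]
  simp [mul_sub]

lemma summable_shift_sq (x : ℤ) : Summable fun y : ℤ => (y : ℝ) ^ 2 * b (y - x) := by
  have h1 : Summable fun y : ℤ => ((y - x : ℤ) : ℝ) ^ 2 * b (y - x) :=
    (Equiv.subRight x).summable_iff.2 hb.summable_sq
  have h2 := (hb.hasSum_shift x).summable
  refine Summable.of_nonneg_of_le (fun y => mul_nonneg (sq_nonneg _) (hb.nonneg _)) (fun y => ?_)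
    ((h1.mul_left 2).add (h2.mul_left (2 * (x : ℝ) ^ 2)))
  push_cast
  -- `2(y - x)² + 2x² - y² = (y - 2x)²`.
  nlinarith [mul_nonneg (sq_nonneg ((y : ℝ) - 2 * x)) (hb.nonneg (y - x))]

lemma hasSum_fourierPotential (x : ℤ) :
    HasSum (fun y : ℤ => b (y - x) * fourierPotential b y)
      (fourierPotential b x + if x = 0 then 1 else 0) := by
  obtain ⟨c, hc, hle⟩ := hb.exists_le_cosQuotient
  have hf := hb.continuous_fejer_div
  have key : HasSum (fun y : ℤ => ∫ θ in -Real.pi..Real.pi,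
      b (y - x) * (fejer y θ / cosQuotient b θ))
      (∫ θ in -Real.pi..Real.pi, (fejer x θ / cosQuotient b θ + Real.cos (x * θ))) := by
    refine intervalIntegral.hasSum_integral_of_dominated_convergence
      (fun y _ => (y : ℝ) ^ 2 * b (y - x) / c)
      (fun y => (continuous_const.mul (hf y)).aestronglyMeasurable)
      (fun y => ae_of_all _ fun θ hθ => ?_)
      (ae_of_all _ fun θ _ => (hb.summable_shift_sq x).div_const c) (by simp) ?_
    · rw [Set.uIoc_of_le (by linarith [Real.pi_pos])] at hθ
      rw [Real.norm_of_nonneg (mul_nonneg (hb.nonneg _)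
        (div_nonneg (fejer_nonneg y θ) (hb.cosQuotient_pos θ).le)), mul_div_assoc', mul_comm]
      exact div_le_div₀ (mul_nonneg (sq_nonneg _) (hb.nonneg _))
        (mul_le_mul_of_nonneg_right (fejer_le y θ) (hb.nonneg _)) hc (hle θ ⟨hθ.1.le, hθ.2⟩)
    · filter_upwards [cos_ne_one_ae] with θ hθ hm
      have hq := (hb.cosQuotient_pos θ).ne'
      have h := (hb.hasSum_shift_fejer x (hθ hm)).div_const (cosQuotient b θ)
      rw [add_div, mul_div_cancel_right₀ _ hq] at h
      exact h.congr_fun fun y => by ring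
  rw [intervalIntegral.integral_add ((hf x).intervalIntegrable _ _)
    (Continuous.intervalIntegrable (by fun_prop) _ _), integral_cos_int_mul] at key
  have hval : (if x = 0 then (1 : ℝ) else 0)
      = (2 * Real.pi)⁻¹ * if x = 0 then 2 * Real.pi else 0 := by
    split_ifs
    · field_simp
    · simp
  rw [hval, fourierPotential, ← mul_add]
  refine (key.mul_left (2 * Real.pi)⁻¹).congr_fun fun y => ?_
  rw [intervalIntegral.integral_const_mul, fourierPotential]
  ring

/-! ### Linear asymptotics -/

lemma exists_abs_fourierPotential_sub_le {ε : ℝ} (hε : 0 < ε) :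
    ∃ C, ∀ x : ℤ, |fourierPotential b x - |(x : ℝ)| / cosQuotient b 0| ≤ ε * |(x : ℝ)| + C := by
  obtain ⟨c, hc, hle⟩ := hb.exists_le_cosQuotient
  have hπ := Real.pi_pos
  have hinv : Continuous fun θ => (cosQuotient b θ)⁻¹ :=
    hb.continuous_quotient.inv₀ fun θ => (hb.cosQuotient_pos θ).ne'
  obtain ⟨δ, hδ, hδ'⟩ := Metric.continuous_iff.1 hinv 0 ε hε
  obtain ⟨δ₀, h₀, h₁, h₂⟩ : ∃ δ₀, 0 < δ₀ ∧ δ₀ ≤ δ ∧ δ₀ ≤ Real.pi :=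
    ⟨min δ Real.pi, lt_min hδ hπ, min_le_left _ _, min_le_right _ _⟩
  have hcos : 0 < 1 - Real.cos δ₀ := by
    have := Real.cos_lt_cos_of_nonneg_of_le_pi le_rfl h₂ h₀
    rw [Real.cos_zero] at this
    linarith
  -- For `|θ| ≥ δ₀` the first factor bounds the Fejér kernel uniformly in `x`, the second bounds
  -- `|1/q(θ) - 1/q(0)|`.
  set D := 2 / (1 - Real.cos δ₀) * (2 * c⁻¹) with hD
  have hDnn : 0 ≤ D := by positivity
  refine ⟨D, fun x => ?_⟩
  have hfx := continuous_fejer x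
  have hpt : ∀ θ ∈ Set.Icc (-Real.pi) Real.pi,
      |fejer x θ * ((cosQuotient b θ)⁻¹ - (cosQuotient b 0)⁻¹)| ≤ fejer x θ * ε + D := by
    intro θ hθ
    have hf0 := fejer_nonneg x θ
    rw [abs_mul, abs_of_nonneg hf0]
    rcases lt_or_ge |θ| δ₀ with h | h
    · have := hδ' θ (by rw [Real.dist_eq, sub_zero]; linarith)
      rw [Real.dist_eq] at this
      nlinarith
    · have h3 : fejer x θ ≤ 2 / (1 - Real.cos δ₀) := by
        rw [le_div_iff₀ hcos]
        have : Real.cos θ ≤ Real.cos δ₀ := by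
          rw [← Real.cos_abs θ]
          exact Real.cos_le_cos_of_nonneg_of_le_pi h₀.le (abs_le.2 hθ) h
        calc fejer x θ * (1 - Real.cos δ₀) ≤ fejer x θ * (1 - Real.cos θ) :=
              mul_le_mul_of_nonneg_left (by linarith) hf0
          _ ≤ 2 := by
            rw [fejer_mul_one_sub_cos]
            linarith [Real.neg_one_le_cos (x * θ)]
      have h4 : ∀ t ∈ Set.Icc (-Real.pi) Real.pi, |(cosQuotient b t)⁻¹| ≤ c⁻¹ := fun t ht => by
        rw [abs_of_pos (inv_pos.2 (hb.cosQuotient_pos t))]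
        exact inv_anti₀ hc (hle t ht)
      have h5 : |(cosQuotient b θ)⁻¹ - (cosQuotient b 0)⁻¹| ≤ 2 * c⁻¹ := by
        refine (abs_sub _ _).trans ?_
        linarith [h4 θ hθ, h4 0 ⟨by linarith, hπ.le⟩]
      calc fejer x θ * |(cosQuotient b θ)⁻¹ - (cosQuotient b 0)⁻¹| ≤ D :=
            mul_le_mul h3 h5 (abs_nonneg _) (by positivity)
        _ ≤ fejer x θ * ε + D := by nlinarith
  have hcont : Continuous fun θ => fejer x θ * ((cosQuotient b θ)⁻¹ - (cosQuotient b 0)⁻¹) :=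
    hfx.mul (hinv.sub continuous_const)
  have heq : fourierPotential b x - |(x : ℝ)| / cosQuotient b 0 = (2 * Real.pi)⁻¹ *
      ∫ θ in -Real.pi..Real.pi, fejer x θ * ((cosQuotient b θ)⁻¹ - (cosQuotient b 0)⁻¹) := by
    simp only [mul_sub, ← div_eq_mul_inv]
    rw [intervalIntegral.integral_sub ((hb.continuous_fejer_div x).intervalIntegrable _ _)
      (Continuous.intervalIntegrable (by fun_prop) _ _), intervalIntegral.integral_div,
      integral_fejer, mul_sub, fourierPotential]
    field_simp
  have hint : |∫ θ in -Real.pi..Real.pi,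
      fejer x θ * ((cosQuotient b θ)⁻¹ - (cosQuotient b 0)⁻¹)|
      ≤ 2 * Real.pi * (ε * |(x : ℝ)| + D) := by
    refine (intervalIntegral.abs_integral_le_integral_abs (by linarith)).trans
      ((intervalIntegral.integral_mono_on (by linarith) (hcont.abs.intervalIntegrable _ _)
        (Continuous.intervalIntegrable (by fun_prop) _ _) hpt).trans_eq ?_)
    rw [intervalIntegral.integral_add (Continuous.intervalIntegrable (by fun_prop) _ _)
      (Continuous.intervalIntegrable (by fun_prop) _ _), intervalIntegral.integral_mul_const,
      integral_fejer]
    simp; ring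
  rw [heq, abs_mul, abs_of_pos (by positivity), inv_mul_le_iff₀ (by positivity)]
  exact hint

lemma tendsto_fourierPotential_div :
    Tendsto (fun x : ℤ => fourierPotential b x / |(x : ℝ)|)
      (comap (fun x : ℤ => |x|) atTop) (𝓝 (1 / cosQuotient b 0)) := by
  rw [Metric.tendsto_nhds]
  intro ε hε
  obtain ⟨C, hC⟩ := hb.exists_abs_fourierPotential_sub_le (half_pos hε)
  have hlim : Tendsto (fun x : ℤ => |(x : ℝ)|) (comap (fun x : ℤ => |x|) atTop) atTop := by
    have := (tendsto_intCast_atTop_atTop (R := ℝ)).comp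
      (tendsto_comap (f := fun x : ℤ => |x|) (x := atTop))
    simpa [Function.comp_def] using this
  filter_upwards [hlim.eventually_gt_atTop 0, hlim.eventually_gt_atTop (C / (ε / 2))] with x h1 h2
  rw [div_lt_iff₀ (half_pos hε)] at h2
  have : fourierPotential b x / |(x : ℝ)| - 1 / cosQuotient b 0
      = (fourierPotential b x - |(x : ℝ)| / cosQuotient b 0) / |(x : ℝ)| := by
    field_simp
  rw [Real.dist_eq, this, abs_div, abs_abs, div_lt_iff₀ h1]
  linarith [hC x]

end IsSymmetricLaw

/-! ### The symmetrized step law -/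

/-- The law of the difference of two independent steps with law `a`. -/
noncomputable def stepSym (a : ℤ → ℝ) (y : ℤ) : ℝ := ∑' z : ℤ, a (z + y) * a z

lemma symKernel_eq (a : ℤ → ℝ) : symKernel a = fun x y => stepSym a (y - x) := rfl

namespace IsStepLaw

variable {a : ℤ → ℝ} (ha : IsStepLaw a)
include ha

lemma le_one (x : ℤ) : a x ≤ 1 := le_hasSum ha.hasSum_one x fun y _ => ha.nonneg y

lemma hasSum_stepSym (y : ℤ) : HasSum (fun z : ℤ => a (z + y) * a z) (stepSym a y) :=
  (Summable.of_nonneg_of_le (fun _ => mul_nonneg (ha.nonneg _) (ha.nonneg _))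
    (fun _ => mul_le_of_le_one_left (ha.nonneg _) (ha.le_one _)) ha.hasSum_one.summable).hasSum

lemma stepSym_nonneg (y : ℤ) : 0 ≤ stepSym a y :=
  tsum_nonneg fun _ => mul_nonneg (ha.nonneg _) (ha.nonneg _)

lemma stepSym_pos {u z : ℤ} (hu : 0 < a u) (hz : 0 < a z) : 0 < stepSym a (u - z) := by
  have := le_hasSum (ha.hasSum_stepSym (u - z)) z
    fun w _ => mul_nonneg (ha.nonneg _) (ha.nonneg _)
  rw [add_sub_cancel] at this
  exact (mul_pos hu hz).trans_le this

lemma exists_pos : ∃ z, 0 < a z := by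
  by_contra! h
  have : a = 0 := funext fun z => le_antisymm (h z) (ha.nonneg z)
  have h1 := ha.hasSum_one
  rw [this] at h1
  exact one_ne_zero (h1.unique hasSum_zero)

lemma stepSym_neg (y : ℤ) : stepSym a (-y) = stepSym a y := by
  refine ((Equiv.addRight y).hasSum_iff.2 (ha.hasSum_stepSym (-y))).unique
    ((ha.hasSum_stepSym y).congr_fun fun z => ?_)
  simp [mul_comm]

/-- Reindex pairs of steps by their difference and the second step, then sum over fibres. -/
lemma hasSum_mul_stepSym {g : ℤ → ℝ} {v : ℝ}
    (h : HasSum (fun p : ℤ × ℤ => g (p.1 - p.2) * (a p.1 * a p.2)) v) :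
    HasSum (fun y => g y * stepSym a y) v := by
  let e : ℤ × ℤ ≃ ℤ × ℤ :=
    { toFun := fun p => (p.2 + p.1, p.2)
      invFun := fun p => (p.1 - p.2, p.2)
      left_inv := fun p => by simp
      right_inv := fun p => by simp }
  refine (e.hasSum_iff.2 h).prod_fiberwise fun y => ?_
  refine ((ha.hasSum_stepSym y).mul_left (g y)).congr_fun fun z => ?_
  simp [e]

lemma stepSym_hasSum_one : HasSum (stepSym a) 1 := by
  have h := ha.hasSum_one.mul ha.hasSum_one
    (ha.hasSum_one.summable.mul_of_nonneg ha.hasSum_one.summable ha.nonneg ha.nonneg)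
  simpa using ha.hasSum_mul_stepSym (g := fun _ => 1) (by simpa using h)

lemma summable_sq : Summable fun x : ℤ => (x : ℝ) ^ 2 * a x := by
  obtain ⟨η, hη, h⟩ := ha.moment
  refine Summable.of_nonneg_of_le (fun x => mul_nonneg (sq_nonneg _) (ha.nonneg x)) (fun x => ?_) h
  refine mul_le_mul_of_nonneg_right ?_ (ha.nonneg x)
  rcases eq_or_ne x 0 with rfl | hx
  · simp; positivity
  · have h1 : (1 : ℝ) ≤ |(x : ℝ)| := by exact_mod_cast Int.one_le_abs hx
    rw [← sq_abs, ← Real.rpow_natCast]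
    exact Real.rpow_le_rpow_of_exponent_le h1 (by push_cast; linarith)

/-- Expand `(x - z)²`; the cross term vanishes because the mean is zero. -/
lemma stepSym_hasSum_sq :
    HasSum (fun y : ℤ => (y : ℝ) ^ 2 * stepSym a y) (2 * sigmaSq a) := by
  have h0 := ha.hasSum_one
  have h1 := ha.mean_zero
  have h2 : HasSum (fun x : ℤ => (x : ℝ) ^ 2 * a x) (sigmaSq a) := ha.summable_sq.hasSum
  have hn2 (x : ℤ) : 0 ≤ (x : ℝ) ^ 2 * a x := mul_nonneg (sq_nonneg _) (ha.nonneg x)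
  have h20 := h2.mul h0 (h2.summable.mul_of_nonneg h0.summable hn2 ha.nonneg)
  have h02 := h0.mul h2 (h0.summable.mul_of_nonneg h2.summable ha.nonneg hn2)
  have h11 := h1.mul h1 (summable_mul_of_summable_norm h1.summable.norm h1.summable.norm)
  have h := (h20.add h02).sub (h11.mul_left 2)
  rw [show sigmaSq a * 1 + 1 * sigmaSq a - 2 * (0 * 0) = 2 * sigmaSq a by ring] at h
  refine ha.hasSum_mul_stepSym (g := fun y => (y : ℝ) ^ 2) (h.congr_fun fun p => ?_)
  push_cast
  ring

/-- Each possible step multiplies `w^position` by the same `ζ`. -/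
lemma exp_pow_eq_of_kernelPow_pos {w ζ : ℂ} (hw : w ≠ 0) (hζ : ∀ z, 0 < a z → w ^ z = ζ) (t : ℕ)
    (x y : ℤ) (h : 0 < kernelPow (walkKernel a) t x y) : w ^ (y - x) = ζ ^ t := by
  induction t generalizing x with
  | zero =>
    have : x = y := by
      by_contra hne
      simp [kernelPow, hne] at h
    simp [this]
  | succ t ih =>
    obtain ⟨z, hz⟩ : ∃ z, 0 < walkKernel a x z * kernelPow (walkKernel a) t z y := by
      by_contra! hle
      exact absurd h (not_lt.2 (tsum_nonpos hle))
    have hk := pos_of_mul_pos_right hz (ha.nonneg _)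
    have ha' : 0 < a (z - x) := pos_of_mul_pos_left hz hk.le
    rw [show y - x = (y - z) + (z - x) by ring, zpow_add₀ hw, ih z hk, hζ _ ha', pow_succ]

/-- If `ψ(θ) = 1`, then `w = e^{iθ}` has `w^z` constant on the support of `a`. Aperiodicity makes
this constant `1`, and a path from `0` to `1` then gives `w = 1`. -/
lemma cosTransform_stepSym_ne_one {θ : ℝ} (hθ : Real.cos θ ≠ 1) :
    cosTransform (stepSym a) θ ≠ 1 := by
  intro h1
  have hs := ha.stepSym_hasSum_one.sub (IsSymmetricLaw.hasSum_cosTransform ha.stepSym_nonneg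
    ha.stepSym_hasSum_one.summable θ)
  rw [h1, sub_self, hasSum_zero_iff_of_nonneg fun y => by
    simpa using mul_le_of_le_one_right (ha.stepSym_nonneg y) (Real.cos_le_one _)] at hs
  set w := Complex.exp (θ * Complex.I) with hwdef
  have hw : w ≠ 0 := Complex.exp_ne_zero _
  obtain ⟨c, hc⟩ := ha.exists_pos
  have hζ : ∀ z, 0 < a z → w ^ z = w ^ c := by
    intro z hz
    have hpos := ha.stepSym_pos hz hc
    have h2 := congrFun hs (z - c)
    simp only [Pi.zero_apply] at h2
    have h3 : Real.cos ((z - c : ℤ) * θ) = 1 := by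
      have : stepSym a (z - c) * (1 - Real.cos ((z - c : ℤ) * θ)) = 0 := by rw [← h2]; ring
      linarith [(mul_eq_zero.1 this).resolve_left hpos.ne']
    have h4 := norm_exp_mul_I_sub_one_sq ((z - c : ℤ) * θ)
    rw [h3, sub_self, mul_zero, sq_eq_zero_iff, norm_eq_zero, sub_eq_zero] at h4
    have h5 : w ^ (z - c) = 1 := by
      rw [← h4, hwdef, ← Complex.exp_int_mul]
      push_cast
      ring_nf
    rwa [zpow_sub₀ hw, div_eq_one_iff_eq (zpow_ne_zero _ hw)] at h5
  have key := ha.exp_pow_eq_of_kernelPow_pos hw hζ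
  have hone : w ^ c = 1 := by
    -- The order of `w^c` divides every return time.
    refine orderOf_eq_one_iff.1 (ha.aperiodic 0 _ fun t _ ht => orderOf_dvd_of_pow_eq_one ?_)
    simpa using (key t 0 0 ht).symm
  obtain ⟨t, ht⟩ := ha.irreducible 0 1
  have hw1 : w = 1 := by simpa [hone] using key t 0 1 ht
  refine hθ ?_
  rw [← Complex.exp_ofReal_mul_I_re, ← hwdef, hw1, Complex.one_re]

lemma cosQuotient_stepSym_pos (θ : ℝ) : 0 < cosQuotient (stepSym a) θ := by
  have h0 := ha.stepSym_nonneg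
  have h1 := ha.stepSym_hasSum_one
  have h2 := ha.stepSym_hasSum_sq.summable
  have main : ∀ θ, Real.cos θ ≠ 1 → 0 < cosQuotient (stepSym a) θ := by
    intro θ hθ
    have hne := sub_pos.2 (lt_of_le_of_ne (Real.cos_le_one θ) hθ)
    have hnn : 0 ≤ cosQuotient (stepSym a) θ :=
      tsum_nonneg fun y => mul_nonneg (h0 y) (fejer_nonneg y θ)
    refine lt_of_le_of_ne hnn fun h => ha.cosTransform_stepSym_ne_one hθ ?_
    have := IsSymmetricLaw.cosQuotient_mul h0 h1 h2 θ
    rw [← h] at this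
    linarith
  by_cases hθ : Real.cos θ = 1
  · rw [IsSymmetricLaw.cosQuotient_of_cos_eq_one hθ]
    -- Here `q` equals `∑ y² b(y)`, which dominates `q` at any angle; `1` is one with cosine `≠ 1`.
    refine (main 1 fun h => ?_).trans_le (hasSum_le (fun y => ?_)
      (IsSymmetricLaw.hasSum_cosQuotient h0 h2 1) h2.hasSum)
    · exact one_ne_zero ((Real.cos_eq_one_iff_of_lt_of_lt (by linarith [Real.pi_gt_three])
        (by linarith [Real.pi_gt_three])).1 h)
    · exact (le_abs_self _).trans (IsSymmetricLaw.norm_mul_fejer_le h0 y 1)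
  · exact main θ hθ

lemma isSymmetricLaw_stepSym : IsSymmetricLaw (stepSym a) where
  nonneg := ha.stepSym_nonneg
  hasSum_one := ha.stepSym_hasSum_one
  symm := ha.stepSym_neg
  summable_sq := ha.stepSym_hasSum_sq.summable
  zero_pos := by
    obtain ⟨z, hz⟩ := ha.exists_pos
    simpa using ha.stepSym_pos hz hz
  cosQuotient_pos := ha.cosQuotient_stepSym_pos

lemma cosQuotient_stepSym_zero : cosQuotient (stepSym a) 0 = 2 * sigmaSq a := by
  rw [IsSymmetricLaw.cosQuotient_of_cos_eq_one Real.cos_zero, ha.stepSym_hasSum_sq.tsum_eq]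

lemma tendsto_greenSum (x : ℤ) :
    Tendsto (fun t : ℕ => greenSum a t 0 0 - greenSum a t x 0) atTop
      (𝓝 (fourierPotential (stepSym a) x)) :=
  ha.isSymmetricLaw_stepSym.tendsto_sum_kernelPow_sub x

lemma potentialKernel_eq : potentialKernel a = fourierPotential (stepSym a) :=
  funext fun x => (ha.tendsto_greenSum x).limUnder_eq

/-- Since `Ā(0) = 0`, the holding term at the origin contributes nothing and the unit excess there
is scaled by `ε`. -/
lemma hasSum_stickyKernel (ε : ℝ) (x : ℤ) :
    HasSum (fun y => stickyKernel a ε x y * potentialKernel a y)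
      (potentialKernel a x + if x = 0 then ε else 0) := by
  rw [ha.potentialKernel_eq]
  have h := ha.isSymmetricLaw_stepSym.hasSum_fourierPotential x
  have hA : fourierPotential (stepSym a) 0 = 0 := by simp [fourierPotential, fejer]
  by_cases hx : x = 0
  · subst hx
    simp only [if_true, hA, zero_add] at h ⊢
    have h' := h.mul_left ε
    rw [mul_one] at h'
    refine h'.congr_fun fun y => ?_
    simp only [stickyKernel, symKernel_eq, if_true]
    by_cases hy : y = 0
    · simp [hy, hA]
    · simp [hy, mul_assoc]
  · simp only [hx, if_false] at h ⊢
    refine h.congr_fun fun y => ?_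
    simp [stickyKernel, symKernel_eq, hx]

lemma stickyKernel_nonneg {ε : ℝ} (h0 : 0 < ε) (h1 : ε ≤ 1) (x y : ℤ) :
    0 ≤ stickyKernel a ε x y := by
  have h : 0 ≤ symKernel a x y := ha.stepSym_nonneg (y - x)
  have h2 : (0 : ℝ) ≤ if y = 0 then 1 else 0 := by split_ifs <;> norm_num
  unfold stickyKernel
  split_ifs
  · exact add_nonneg (mul_nonneg (by linarith) (by norm_num)) (mul_nonneg h0.le h)
  · exact add_nonneg (mul_nonneg (by linarith) (by norm_num)) (mul_nonneg h0.le h)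
  · exact h

end IsStepLaw

/-! ### The Markov property for nonnegative functions -/

namespace IsMarkovChain

variable {Ω : Type*} {m : MeasurableSpace Ω} {μ : Measure Ω}
  {ℱ : Filtration ℕ m} {S : ℕ → Ω → ℤ} {P : ℤ → ℤ → ℝ}

lemma measurable (h : IsMarkovChain P S ℱ μ) (t : ℕ) : Measurable (S t) :=
  (h.adapted t).mono (ℱ.le t) le_rfl

variable [IsProbabilityMeasure μ]

lemma setLIntegral_transition (h : IsMarkovChain P S ℱ μ) (hP : ∀ x y, 0 ≤ P x y) (t : ℕ) (y : ℤ)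
    {s : Set Ω} (hs : MeasurableSet[ℱ t] s) :
    ∫⁻ ω in s, ENNReal.ofReal (if S (t + 1) ω = y then 1 else 0) ∂μ
      = ∫⁻ ω in s, ENNReal.ofReal (P (S t ω) y) ∂μ := by
  have hint : Integrable (fun ω => if S (t + 1) ω = y then (1 : ℝ) else 0) μ := by
    refine Integrable.of_bound (C := 1) ?_ (ae_of_all _ fun ω => by split_ifs <;> simp)
    exact ((Measurable.of_discrete (f := fun z : ℤ => if z = y then (1 : ℝ) else 0)).comp
      (h.measurable (t + 1))).aestronglyMeasurable
  have hint' : Integrable (fun ω => P (S t ω) y) μ :=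
    integrable_condExp.congr (h.transition t y)
  rw [← ofReal_integral_eq_lintegral_ofReal hint.integrableOn
      (ae_of_all _ fun ω => by dsimp only; split_ifs <;> simp),
    ← ofReal_integral_eq_lintegral_ofReal hint'.integrableOn (ae_of_all _ fun ω => hP _ _),
    ← setIntegral_condExp (ℱ.le t) hint hs]
  congr 1
  exact integral_congr_ae (ae_restrict_of_ae (h.transition t y))

/-- Write `f(S(t+1))` as a sum over values `y` and apply the transition law termwise. Lower
integrals allow the interchange before integrability is known. -/
lemma setLIntegral_comp (h : IsMarkovChain P S ℱ μ) (hP : ∀ x y, 0 ≤ P x y) {f g : ℤ → ℝ}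
    (hf : ∀ y, 0 ≤ f y) (hfg : ∀ x, HasSum (fun y => P x y * f y) (g x)) (t : ℕ)
    {s : Set Ω} (hs : MeasurableSet[ℱ t] s) :
    ∫⁻ ω in s, ENNReal.ofReal (f (S (t + 1) ω)) ∂μ = ∫⁻ ω in s, ENNReal.ofReal (g (S t ω)) ∂μ := by
  have hmeas (q : ℤ → ENNReal) (r : ℕ) : Measurable fun ω => q (S r ω) :=
    (Measurable.of_discrete (f := q)).comp (h.measurable r)
  have h1 (ω : Ω) : ENNReal.ofReal (f (S (t + 1) ω))
      = ∑' y : ℤ, ENNReal.ofReal (f y) * ENNReal.ofReal (if S (t + 1) ω = y then 1 else 0) := by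
    rw [tsum_eq_single (S (t + 1) ω) fun y hy => by simp [hy.symm]]
    simp
  have h2 (ω : Ω) : ENNReal.ofReal (g (S t ω))
      = ∑' y : ℤ, ENNReal.ofReal (f y) * ENNReal.ofReal (P (S t ω) y) := by
    rw [← (hfg (S t ω)).tsum_eq, ENNReal.ofReal_tsum_of_nonneg
      (fun y => mul_nonneg (hP _ _) (hf y)) (hfg _).summable]
    exact tsum_congr fun y => by rw [mul_comm, ENNReal.ofReal_mul (hf y)]
  simp only [h1, h2]
  rw [lintegral_tsum fun y => (hmeas (fun z => ENNReal.ofReal (f y) *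
      ENNReal.ofReal (if z = y then 1 else 0)) (t + 1)).aemeasurable,
    lintegral_tsum fun y => (hmeas (fun z => ENNReal.ofReal (f y) *
      ENNReal.ofReal (P z y)) t).aemeasurable]
  refine tsum_congr fun y => ?_
  rw [lintegral_const_mul' _ _ ENNReal.ofReal_ne_top, lintegral_const_mul' _ _ ENNReal.ofReal_ne_top,
    h.setLIntegral_transition hP t y hs]

lemma integrable_comp (h : IsMarkovChain P S ℱ μ) (hP : ∀ x y, 0 ≤ P x y) {f g : ℤ → ℝ}
    (hf : ∀ y, 0 ≤ f y) (hfg : ∀ x, HasSum (fun y => P x y * f y) (g x)) {t : ℕ}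
    (hg : Integrable (fun ω => g (S t ω)) μ) : Integrable (fun ω => f (S (t + 1) ω)) μ := by
  have hm : Measurable fun ω => f (S (t + 1) ω) :=
    (Measurable.of_discrete (f := f)).comp (h.measurable (t + 1))
  have hg0 (x : ℤ) : 0 ≤ g x := (hfg x).nonneg fun y => mul_nonneg (hP x y) (hf y)
  refine ⟨hm.aestronglyMeasurable, ?_⟩
  rw [hasFiniteIntegral_iff_ofReal (ae_of_all _ fun ω => hf _), ← setLIntegral_univ,
    h.setLIntegral_comp hP hf hfg t MeasurableSet.univ, setLIntegral_univ,
    ← hasFiniteIntegral_iff_ofReal (ae_of_all _ fun ω => hg0 _)]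
  exact hg.2

/-- The Markov property extended to nonnegative functions. -/
lemma condExp_comp (h : IsMarkovChain P S ℱ μ) (hP : ∀ x y, 0 ≤ P x y) {f g : ℤ → ℝ}
    (hf : ∀ y, 0 ≤ f y) (hfg : ∀ x, HasSum (fun y => P x y * f y) (g x)) {t : ℕ}
    (hg : Integrable (fun ω => g (S t ω)) μ) :
    (fun ω => g (S t ω)) =ᵐ[μ] μ[fun ω => f (S (t + 1) ω) | ℱ t] := by
  have hfi := h.integrable_comp hP hf hfg hg
  have hg0 (x : ℤ) : 0 ≤ g x := (hfg x).nonneg fun y => mul_nonneg (hP x y) (hf y)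
  refine ae_eq_condExp_of_forall_setIntegral_eq (ℱ.le t) hfi (fun s _ _ => hg.integrableOn)
    (fun s hs _ => ?_) ?_
  · rw [integral_eq_lintegral_of_nonneg_ae (ae_of_all _ fun ω => hg0 _) hg.1.restrict,
      integral_eq_lintegral_of_nonneg_ae (ae_of_all _ fun ω => hf _) hfi.1.restrict,
      h.setLIntegral_comp hP hf hfg t hs]
  · exact ((Measurable.of_discrete (f := g)).comp (h.adapted t)).stronglyMeasurable.aestronglyMeasurable

end IsMarkovChain

/-! ### The martingale -/

lemma IsStepLaw.martingale_potentialKernel {a : ℤ → ℝ} (ha : IsStepLaw a) {ε : ℝ} (h0 : 0 < ε)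
    (h1 : ε ≤ 1) {Ω : Type*} {m : MeasurableSpace Ω} {μ : Measure Ω} [IsProbabilityMeasure μ]
    {ℱ : Filtration ℕ m} {S : ℕ → Ω → ℤ} (hS : IsMarkovChain (stickyKernel a ε) S ℱ μ)
    (hS0 : Integrable (fun ω => (S 0 ω : ℝ)) μ) :
    Martingale (fun (t : ℕ) (ω : Ω) => potentialKernel a (S t ω) -
      ε * ∑ s ∈ Finset.range t, (if S s ω = 0 then (1 : ℝ) else 0)) ℱ μ := by
  set A := potentialKernel a with hA
  have hb := ha.isSymmetricLaw_stepSym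
  have hA0 (x : ℤ) : 0 ≤ A x := by
    rw [hA, ha.potentialKernel_eq]; exact hb.fourierPotential_nonneg x
  have hP := ha.stickyKernel_nonneg h0 h1
  have hmeas (q : ℤ → ℝ) {r t : ℕ} (hrt : r ≤ t) : Measurable[ℱ t] fun ω => q (S r ω) :=
    (Measurable.of_discrete (f := q)).comp ((hS.adapted r).mono (ℱ.mono hrt) le_rfl)
  have hind (t : ℕ) (c : ℝ) : Integrable (fun ω => if S t ω = 0 then c else 0) μ := by
    refine Integrable.of_bound (C := |c|) ?_ (ae_of_all _ fun ω => by split_ifs <;> simp)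
    exact ((hmeas (fun z => if z = 0 then c else 0) le_rfl).mono
      (ℱ.le t) le_rfl).aestronglyMeasurable
  have hAint (t : ℕ) : Integrable (fun ω => A (S t ω)) μ := by
    induction t with
    | zero =>
      obtain ⟨C, hC⟩ := hb.exists_fourierPotential_le
      refine (hS0.abs.const_mul C).mono' ((hmeas A le_rfl).mono
        (ℱ.le 0) le_rfl).aestronglyMeasurable (ae_of_all _ fun ω => ?_)
      rw [Real.norm_of_nonneg (hA0 _), hA, ha.potentialKernel_eq]
      exact hC _
    | succ t ih =>
      exact hS.integrable_comp hP hA0 (ha.hasSum_stickyKernel ε) (ih.add (hind t ε))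
  -- The bound `t + 1` expresses predictability: the compensator at time `t + 1` only involves
  -- `S(0), …, S(t)`.
  have hLmeas (t : ℕ) {r : ℕ} (hr : r ≤ t + 1) : Measurable[ℱ t] fun ω =>
      ε * ∑ s ∈ Finset.range r, (if S s ω = 0 then (1 : ℝ) else 0) :=
    (Finset.measurable_fun_sum _ fun s hs => hmeas (fun z => if z = 0 then (1 : ℝ) else 0)
      (by have := Finset.mem_range.1 hs; omega)).const_mul ε
  have hLint (t : ℕ) : Integrable (fun ω =>
      ε * ∑ s ∈ Finset.range t, (if S s ω = 0 then (1 : ℝ) else 0)) μ :=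
    (integrable_finsetSum _ fun s _ => hind s 1).const_mul ε
  refine martingale_nat (fun t => ((hmeas A le_rfl).sub (hLmeas t (by omega))).stronglyMeasurable)
    (fun t => (hAint t).sub (hLint t)) fun t => ?_
  have hstep := hS.condExp_comp hP hA0 (ha.hasSum_stickyKernel ε) ((hAint t).add (hind t ε))
  have hL := condExp_of_stronglyMeasurable (ℱ.le t) (hLmeas t le_rfl).stronglyMeasurable
    (hLint (t + 1))
  filter_upwards [hstep, condExp_sub (hAint (t + 1)) (hLint (t + 1)) (ℱ t)] with ω h2 h3
  refine Eq.trans ?_ h3.symm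
  rw [Pi.sub_apply, ← h2, hL]
  dsimp only
  rw [Finset.sum_range_succ]
  split_ifs <;> ring

end StickyWalk

theorem proposition3p3 (a : ℤ → ℝ) (ha : StickyWalk.IsStepLaw a) :
    (∀ x : ℤ, Tendsto (fun t : ℕ => StickyWalk.greenSum a t 0 0 - StickyWalk.greenSum a t x 0)
      atTop (𝓝 (StickyWalk.potentialKernel a x))) ∧
    (∀ (ε : ℝ), 0 < ε → ε ≤ 1 →
      ∀ (Ω : Type*) (m : MeasurableSpace Ω) (μ : Measure Ω) [IsProbabilityMeasure μ]
        (ℱ : Filtration ℕ m) (S : ℕ → Ω → ℤ),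
        StickyWalk.IsMarkovChain (StickyWalk.stickyKernel a ε) S ℱ μ →
        Integrable (fun ω => (S 0 ω : ℝ)) μ →
        Martingale
          (fun (t : ℕ) (ω : Ω) => StickyWalk.potentialKernel a (S t ω) -
            ε * ∑ s ∈ Finset.range t, (if S s ω = 0 then (1 : ℝ) else 0)) ℱ μ) ∧
    Tendsto (fun x : ℤ => StickyWalk.potentialKernel a x / |(x : ℝ)|)
      (comap (fun x : ℤ => |x|) atTop) (𝓝 (1 / (2 * StickyWalk.sigmaSq a))) := by
  refine ⟨fun x => ?_, fun ε h0 h1 Ω m μ _ ℱ S hS hS0 =>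
    ha.martingale_potentialKernel h0 h1 hS hS0, ?_⟩
  · rw [ha.potentialKernel_eq]
    exact ha.tendsto_greenSum x
  · rw [ha.potentialKernel_eq, ← ha.cosQuotient_stepSym_zero]
    exact ha.isSymmetricLaw_stepSym.tendsto_fourierPotential_div
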